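/- Let $F$ be an oriented connected surface, possibly with boundary (for instance a compact one, or $\mathbb R^2$). A tangle diagram in $F$ is a compact embedded finite graph with vertices of valence $1$ (precisely its points on $\partial F$) and of valence $4$ (crossings, each classical or virtual; closed components without vertices are allowed), considered up to isotopy fixed on the boundary. A diagram without virtual crossings is called classical. A link diagram is a diagram without long components, and a knot diagram is a link diagram with one (unicursal) component. Let $\mathscr K$ be the set of classical, virtual or welded knots (or links, or tangles) in $F$, oriented or not, i.e. the set of the corresponding diagrams modulo isotopy and the Reidemeister moves of the theory: $\Omega_1,\Omega_2,\Omega_3$ on classical diagrams in the classical case; these together with $V\Omega_1,V\Omega_2,V\Omega_3,SV\Omega_3$ in the virtual case; and, in addition, the forbidden move $F^o$ (a strand with two overcrossings passes a virtual crossing) in the welded case. An $n$-tangle is a diagram (of the theory considered) in a standard disk whose boundary is a fixed enumerated set of $2n$ points of the boundary circle. A (monomial) local move of degree $n$ is a pair $M=(T,T')$ of $n$-tangles with the same boundary (including the directions of the strands at the boundary, in the oriented case). It is applied to a diagram $D$ by replacing, in a disk $B\subset F$ identified with the standard disk by an orientation-preserving homeomorphism which takes $D\cap B$ to $T$, the subtangle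 $T$ by $T'$. For a set $\mathcal M$ of moves let $\mathscr K/\mathcal M$ be the quotient of $\mathscr K$ by the equivalence relation generated by the applications of moves $M\in\mathcal M$ to diagrams, and let $p\colon\mathscr K\to\mathscr K/\mathcal M$ be the projection. A map $I\colon\mathscr K\to X$ to a set $X$ is a skein invariant of degree $n$ if there are a finite set $\mathcal M$ of local moves of degree $n$ and an injection $f\colon\mathscr K/\mathcal M\to X$ with $I=f\circ p$. Let $\mathscr I_n$ be the set of skein invariants $\mathscr K\to X$ of degree $n$. Then for every $n\ge 1$ one has $\mathscr I_n\subset\mathscr I_{n+1}$: every skein invariant of degree $n$ is also a skein invariant of degree $n+1$. -/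

import Mathlib

open Set Filter Topology

noncomputable section

namespace Skein

/-- The three theories: classical diagrams up to the classical Reidemeister moves, and virtual and
welded ones, whose diagrams may have virtual crossings. -/
inductive Kind
  | classical
  | virt
  | welded

/-- The three classes of objects. -/
inductive Shape
  | knot
  | link
  | tangle

/-- Raw data of a diagram in `F`. The germ at `p` of a set `S` is recorded as the filter `𝓝[S] p`.
`carrier` is the underlying embedded graph; `overpass p` is the germ at `p` of the overcrossing
strand if `p` is a classical crossing, and `⊥` at all other points (virtual crossings included);
`fwd p` is the germ at `p` of the outgoing half-strands if the diagram is oriented, and `⊥` if it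
is not. -/
@[ext]
structure PreDiagram (F : Type*) where
  carrier : Set F
  overpass : F → Filter F
  fwd : F → Filter F

namespace PreDiagram

variable {E F : Type*}

/-- Pull-back along a map (used for embeddings). -/
def comap (f : E → F) (D : PreDiagram F) : PreDiagram E where
  carrier := f ⁻¹' D.carrier
  overpass z := Filter.comap f (D.overpass (f z))
  fwd z := Filter.comap f (D.fwd (f z))

/-- `D` and `D'` coincide at all points that are not in `S`. -/
def AgreeOff (S : Set F) (D D' : PreDiagram F) : Prop :=
  ∀ p, p ∉ S → (p ∈ D.carrier ↔ p ∈ D'.carrier) ∧ D.overpass p = D'.overpass p ∧ D.fwd p = D'.fwd p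

end PreDiagram

/-- The horizontal axis of the plane. -/
def axis : Set ℂ := {z | z.im = 0}

/-- The union of the two axes of the plane. -/
def cross : Set ℂ := {z | z.re = 0 ∨ z.im = 0}

open Classical in
/-- Local models in the plane: the graph `S` (`axis` or `cross`). If `c` is true, the origin is a
classical crossing with the horizontal strand on top. If `o` is true, the strands are oriented in
the positive direction of the axes. -/
def model (S : Set ℂ) (c o : Bool) : PreDiagram ℂ where
  carrier := S
  overpass z := if c = true ∧ z = 0 then 𝓝[axis] 0 else ⊥
  fwd z := if o = true ∧ z ∈ S then 𝓝[{w ∈ S | z.re + z.im < w.re + w.im}] z else ⊥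

section Diagrams

variable {F : Type*} [TopologicalSpace F]

/-- The germs are germs at the right points, and only points of the graph carry germs. -/
def HasGerms (D : PreDiagram F) : Prop :=
  (∀ p, D.overpass p ≤ 𝓝 p ∧ D.fwd p ≤ 𝓝 p) ∧ ∀ p, p ∉ D.carrier → D.overpass p = ⊥ ∧ D.fwd p = ⊥

/-- Near its interior point `p`, the diagram is an edge, a classical crossing, or (unless the theory
is the classical one) a virtual crossing. -/
def RegularAt (k : Kind) (o : Bool) (D : PreDiagram F) (p : F) : Prop :=
  ∃ ψ : ℂ → F, IsOpenEmbedding ψ ∧ ψ 0 = p ∧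
    (D.comap ψ = model axis false o ∨ D.comap ψ = model cross true o ∨
      (k ≠ Kind.classical ∧ D.comap ψ = model cross false o))

/-- Near `p`, the diagram is an edge that ends at the boundary point `p`. In the oriented case it
points away from the boundary or towards it. -/
def EndsAt (o : Bool) (D : PreDiagram F) (p : F) : Prop :=
  ∃ ψ : {z : ℂ // 0 ≤ z.re} → F, IsOpenEmbedding ψ ∧ ψ ⟨0, le_rfl⟩ = p ∧
    (D.comap ψ = (model axis false o).comap (fun z : {z : ℂ // 0 ≤ z.re} => (z : ℂ)) ∨
      D.comap ψ = (model axis false o).comap (fun z : {z : ℂ // 0 ≤ z.re} => -(z : ℂ)))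

/-- `p` is a 4-valent vertex of the graph. -/
def IsCrossing (D : PreDiagram F) (p : F) : Prop :=
  ∃ ψ : ℂ → F, IsOpenEmbedding ψ ∧ ψ 0 = p ∧ ψ ⁻¹' D.carrier = cross

/-- The curves `γ i` run along the diagram, going straight through the crossings, and together they
cover every edge exactly once: they are parametrizations of the unicursal components of `D`, one
curve for each component. -/
def Traverses {ι P : Type*} [TopologicalSpace P] (γ : ι → P → F) (D : PreDiagram F) : Prop :=
  (∀ i, Continuous (γ i)) ∧ (∀ i s, γ i s ∈ D.carrier) ∧
  (∀ p ∈ D.carrier, ¬ IsCrossing D p → {x : ι × P | γ x.1 x.2 = p}.encard = 1) ∧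
  (∀ p ∈ D.carrier, IsCrossing D p → {x : ι × P | γ x.1 x.2 = p}.encard = 2) ∧
  ∀ i s, IsCrossing D (γ i s) → ∃ ψ : ℂ → F, IsOpenEmbedding ψ ∧ ψ 0 = γ i s ∧
    ψ ⁻¹' D.carrier = cross ∧ ∀ᶠ u in 𝓝 s, γ i u ∈ ψ '' axis

/-- An orientation of a connected surface `F`, given by its positively oriented embedded open
disks: isotopic embedded disks have the same sign, and precisely one of a disk and its mirror
image is positive. -/
structure SurfaceOrientation (F : Type*) [TopologicalSpace F] where
  positive : Set (ℂ → F)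
  isOpenEmbedding : ∀ h ∈ positive, IsOpenEmbedding h
  isotopy : ∀ H : unitInterval → ℂ → F, Continuous (fun x : unitInterval × ℂ => H x.1 x.2) →
    (∀ t, IsOpenEmbedding (H t)) → H 0 ∈ positive → H 1 ∈ positive
  mirror : ∀ h : ℂ → F, IsOpenEmbedding h →
    (h ∈ positive ↔ (fun z => h ((starRingEnd ℂ) z)) ∉ positive)

end Diagrams

/-! ### Tangles in the standard disk and local moves

The standard disk is the closed rectangle `[0, 2n+1] × [-1, 0]`, and its marked boundary points are
`(1, 0), …, (2n, 0)`. A tangle in it is drawn in the plane, prolonged by the vertical rays that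
start at the marked points, so that it meets the boundary of the disk transversally. -/

/-- The interior of the standard disk. -/
def box (n : ℕ) : Set ℂ := {z | 0 < z.re ∧ z.re < 2 * n + 1 ∧ -1 < z.im ∧ z.im < 0}

/-- Vertical half-lines through the marked points. They begin inside of the disk. -/
def rays (n : ℕ) : Set ℂ := {z | (∃ j : ℕ, 1 ≤ j ∧ j ≤ 2 * n ∧ z.re = j) ∧ -(1 / 2) < z.im}

/-- `n`-tangles: diagrams in the standard disk with the `2n` marked points as boundary. -/
def IsTangle (k : Kind) (o : Bool) (n : ℕ) (T : PreDiagram ℂ) : Prop :=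
  IsClosed T.carrier ∧ HasGerms T ∧ (∀ p ∈ T.carrier, RegularAt k o T p) ∧
    ∃ K : Set ℂ, IsCompact K ∧ K ⊆ box n ∧ ∀ z, z ∉ K → (z ∈ T.carrier ↔ z ∈ rays n)

/-- A (monomial) local move of degree `n`: two `n`-tangles with the same boundary. -/
structure LocalMove (k : Kind) (o : Bool) (n : ℕ) where
  source : PreDiagram ℂ
  target : PreDiagram ℂ
  source_isTangle : IsTangle k o n source
  target_isTangle : IsTangle k o n target
  boundary_eq : PreDiagram.AgreeOff (box n) source target

/-- No crossings. -/
def CrossingFree (T : PreDiagram ℂ) : Prop := ∀ p, ¬ IsCrossing T p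

/-- At a common point `γ i s = γ j t` of the `i`-th and the `j`-th strand, the `i`-th strand is on
top (`c = true`), or the crossing is virtual (`c = false`). -/
def CrossesAs {m : ℕ} (c : Bool) (T : PreDiagram ℂ) (γ : Fin m → ℝ → ℂ) (i j : Fin m) : Prop :=
  ∀ s t, γ i s = γ j t → T.overpass (γ i s) = if c = true then Filter.map (γ i) (𝓝 s) else ⊥

/-- The first Reidemeister move (classical for `c = true`, virtual for `c = false`): a strand with
one crossing is replaced by a strand without crossings. -/
def IsOmega1 (c : Bool) (T T' : PreDiagram ℂ) : Prop :=
  ∃ γ γ' : Fin 1 → ℝ → ℂ, Traverses γ T ∧ Traverses γ' T' ∧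
    (∃! p, IsCrossing T p) ∧ (∀ p, IsCrossing T p → (T.overpass p ≠ ⊥ ↔ c = true)) ∧ CrossingFree T'

/-- The second Reidemeister move (classical or virtual): two simple strands that cross twice, the
same strand being on top at both crossings in the classical case, are replaced by two disjoint
simple strands with the same ends. -/
def IsOmega2 (c : Bool) (T T' : PreDiagram ℂ) : Prop :=
  ∃ γ γ' : Fin 2 → ℝ → ℂ, Traverses γ T ∧ Traverses γ' T' ∧
    (∀ i, γ i =ᶠ[cocompact ℝ] γ' i) ∧ (∀ i, Function.Injective (γ i)) ∧
    {p | IsCrossing T p}.encard = 2 ∧ CrossesAs c T γ 0 1 ∧ CrossingFree T'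

/-- `T` consists of three simple strands; any two of them cross once, with crossing types
`a` (strands 0 and 1), `b` (strands 0 and 2), `c` (strands 1 and 2). -/
def IsTriangle (a b c : Bool) (T : PreDiagram ℂ) (γ : Fin 3 → ℝ → ℂ) : Prop :=
  Traverses γ T ∧ (∀ i, Function.Injective (γ i)) ∧
    (∀ i j, i ≠ j → ∃! x : ℝ × ℝ, γ i x.1 = γ j x.2) ∧
    CrossesAs a T γ 0 1 ∧ CrossesAs b T γ 0 2 ∧ CrossesAs c T γ 1 2

/-- Moves of the type of the third Reidemeister move: for given ends and crossing types there are,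
up to isotopy, two tangles as in `IsTriangle`, and any such tangle is replaced by any other. -/
def IsOmega3 (a b c : Bool) (T T' : PreDiagram ℂ) : Prop :=
  ∃ γ γ' : Fin 3 → ℝ → ℂ, IsTriangle a b c T γ ∧ IsTriangle a b c T' γ' ∧
    ∀ i, γ i =ᶠ[cocompact ℝ] γ' i

/-- The Reidemeister moves of the three theories. In the oriented case all orientations of the
strands are allowed. -/
inductive IsReidemeister (k : Kind) (o : Bool) : (n : ℕ) → LocalMove k o n → Prop
  | omega1 (M : LocalMove k o 1) : IsOmega1 true M.source M.target → IsReidemeister k o 1 M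
  | omega2 (M : LocalMove k o 2) : IsOmega2 true M.source M.target → IsReidemeister k o 2 M
  | omega3 (M : LocalMove k o 3) : IsOmega3 true true true M.source M.target →
      IsReidemeister k o 3 M
  | virt1 (M : LocalMove k o 1) : k ≠ Kind.classical → IsOmega1 false M.source M.target →
      IsReidemeister k o 1 M
  | virt2 (M : LocalMove k o 2) : k ≠ Kind.classical → IsOmega2 false M.source M.target →
      IsReidemeister k o 2 M
  | virt3 (M : LocalMove k o 3) : k ≠ Kind.classical →
      IsOmega3 false false false M.source M.target → IsReidemeister k o 3 M
  /-- A strand with virtual crossings passes a classical crossing. -/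
  | semivirt3 (M : LocalMove k o 3) : k ≠ Kind.classical →
      IsOmega3 false false true M.source M.target → IsReidemeister k o 3 M
  /-- A strand with overcrossings passes a virtual crossing. -/
  | forbidden (M : LocalMove k o 3) : k = Kind.welded →
      IsOmega3 true true false M.source M.target → IsReidemeister k o 3 M

/-! ### Diagrams in a surface, knots, and skein invariants -/

section Surface

variable (F : Type*) [TopologicalSpace F] [ChartedSpace (EuclideanHalfSpace 2) F]

/-- The boundary of the surface. -/
def bdry : Set F := (modelWithCornersEuclideanHalfSpace 2).boundary F

variable {F}

/-- Tangle diagrams in the surface `F`. -/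
def IsDiagram (k : Kind) (o : Bool) (D : PreDiagram F) : Prop :=
  IsCompact D.carrier ∧ HasGerms D ∧ (∀ p ∈ D.carrier, p ∉ bdry F → RegularAt k o D p) ∧
    ∀ p ∈ D.carrier, p ∈ bdry F → EndsAt o D p

/-- Links have no long components; knots are links with one component. -/
def HasShape : Shape → PreDiagram F → Prop
  | Shape.tangle, _ => True
  | Shape.link, D => Disjoint D.carrier (bdry F)
  | Shape.knot, D => Disjoint D.carrier (bdry F) ∧ ∃ γ : Unit → Circle → F, Traverses γ D

variable (F) in
/-- Diagrams of knots, links, or tangles in `F`. -/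
def Diagram (k : Kind) (s : Shape) (o : Bool) : Type _ :=
  {D : PreDiagram F // IsDiagram k o D ∧ HasShape s D}

/-- Ambient isotopy of diagrams, fixed on the boundary of the surface. -/
def Isotopic (D D' : PreDiagram F) : Prop :=
  ∃ H : unitInterval → F ≃ₜ F, Continuous (fun x : unitInterval × F => H x.1 x.2) ∧
    (∀ p, H 0 p = p) ∧ (∀ t, ∀ p ∈ bdry F, H t p = p) ∧ D'.comap (H 1) = D

/-- `D'` is obtained from `D` by an application of the move `M`: there is a positively oriented
embedded disk (with a neighbourhood `range h` of it) that meets `D` in the tangle `M.source`, and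
`D'` differs from `D` only in this disk, which it meets in `M.target`. -/
def Applies (ω : SurfaceOrientation F) {k : Kind} {o : Bool} {n : ℕ} (M : LocalMove k o n)
    (D D' : PreDiagram F) : Prop :=
  ∃ h ∈ ω.positive, range h ⊆ (bdry F)ᶜ ∧ D.comap h = M.source ∧ D'.comap h = M.target ∧
    PreDiagram.AgreeOff (h '' box n) D D'

variable (ω : SurfaceOrientation F) (k : Kind) (s : Shape) (o : Bool)

/-- The set of knots (links, tangles) in `F`: diagrams modulo the equivalence relation generated by
isotopies and Reidemeister moves. -/
def Knots : Type _ :=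
  Quot fun D D' : Diagram F k s o => Isotopic D.1 D'.1 ∨
    ∃ (n : ℕ) (M : LocalMove k o n), IsReidemeister k o n M ∧ Applies ω M D.1 D'.1

/-- The set of equivalence classes of knots modulo a set of moves of degree `n`. -/
def SkeinQuotient {n : ℕ} (𝓜 : Set (LocalMove k o n)) : Type _ :=
  Quot fun K K' : Knots ω k s o => ∃ (D D' : Diagram F k s o) (M : LocalMove k o n),
    Quot.mk _ D = K ∧ Quot.mk _ D' = K' ∧ M ∈ 𝓜 ∧ Applies ω M D.1 D'.1

/-- The natural projection. -/
def skeinProj {n : ℕ} (𝓜 : Set (LocalMove k o n)) (K : Knots ω k s o) :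
    SkeinQuotient ω k s o 𝓜 :=
  Quot.mk _ K

/-- The set of `X`-valued skein invariants of degree `n`: those determined by a finite set of
(monomial) moves of degree `n`. -/
def skeinInvariants (X : Type*) (n : ℕ) : Set (Knots ω k s o → X) :=
  {I | ∃ 𝓜 : Set (LocalMove k o n), 𝓜.Finite ∧
    ∃ f : SkeinQuotient ω k s o 𝓜 → X, Function.Injective f ∧ I = f ∘ skeinProj ω k s o 𝓜}

end Surface

end Skein

end

/-!
Every move `M` of degree `n ≥ 1` can be replaced by one move of degree `n + 1` that has exactly the
same applications to diagrams (`applies_raise_iff`), so that replacing all moves of a finite set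
changes neither the quotient of the set of knots nor the invariants that factor through it.

The raised move adds to both tangles of `M` a strand without crossings that connects the two new
boundary points. If `M` is applied in some disk, this strand is provided by the diagram itself: the
strand that leaves the disk at its last marked point passes along an arc outside of the disk, and
the disk can be bent around until it contains a piece of this arc as well. In formulas, there is an
open embedding `bend n` of the plane whose range omits a set cutting the last ray, such that the
rays of degree `n` pull back to the rays of degree `n + 1`, up to the bottom of the new strand
(`bend_mem_rays_iff`). The raised move is by definition the pull-back of `M` along `bend n`; in
particular, the orientation of the new strand is forced by that of the last strand of `M`. If `h` is
a disk in which `M` applies, then `h ∘ bend n` is a disk in which the raised move applies.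

Conversely, if the raised move applies in a disk `h`, then `M` applies in a disk `h ∘ e`, where
`bend n ∘ e` is the identity in the lower half-plane and shortens all rays
(`exists_bend_section`). Here one needs that such a shortening does not change a tangle
(`IsTangle.comap_coordMap_id`), that is, that a tangle has no crossings on the rays and is
consistently oriented along each of them (`IsTangle.germs_on_rays`).

Both reparametrizations are the identity near some point, and are therefore isotopic to the identity
by conjugation with dilations, so they take positive disks to positive disks
(`SurfaceOrientation.comp_mem_positive`).
-/

open Set Filter Topology

noncomputable section

namespace Skein

/-! ### Open embeddings of the line and of the plane -/

lemma isOpenEmbedding_of_strictMono {f : ℝ → ℝ} (hf : StrictMono f) (hc : Continuous f) :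
    IsOpenEmbedding f := by
  have ho : (range f).OrdConnected := (isPreconnected_range hc).ordConnected
  refine ⟨hf.isEmbedding_of_ordConnected ho, isOpen_iff_mem_nhds.2 ?_⟩
  rintro _ ⟨x, rfl⟩
  exact mem_of_superset (Ioo_mem_nhds (hf (sub_one_lt x)) (hf (lt_add_one x)))
    (Ioo_subset_Icc_self.trans (ho.out (mem_range_self _) (mem_range_self _)))

lemma isOpen_range_of_injective {f : ℝ → ℝ} (hc : Continuous f) (hf : Function.Injective f) :
    IsOpen (range f) := by
  rcases hc.strictMono_of_inj hf with h | h
  · exact (isOpenEmbedding_of_strictMono h hc).isOpen_range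
  · have h2 := (isOpenEmbedding_of_strictMono (f := fun x => f (-x))
      (fun a b hab => h (neg_lt_neg hab)) (hc.comp continuous_neg)).isOpen_range
    rwa [show (fun x => f (-x)) = f ∘ Neg.neg from rfl, neg_surjective.range_comp] at h2

lemma continuous_complex_mk {X : Type*} [TopologicalSpace X] {f g : X → ℝ} (hf : Continuous f)
    (hg : Continuous g) : Continuous fun x => (⟨f x, g x⟩ : ℂ) :=
  Complex.equivRealProdCLM.symm.continuous.comp (hf.prodMk hg)

/-- The product of two self-maps of the line, acting on the coordinates of the plane. -/
def coordMap (f g : ℝ → ℝ) (z : ℂ) : ℂ := ⟨f z.re, g z.im⟩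

lemma isOpenEmbedding_coordMap {f g : ℝ → ℝ} (hf : IsOpenEmbedding f) (hg : IsOpenEmbedding g) :
    IsOpenEmbedding (coordMap f g) :=
  Complex.equivRealProdCLM.symm.toHomeomorph.isOpenEmbedding.comp
    ((hf.prodMap hg).comp Complex.equivRealProdCLM.toHomeomorph.isOpenEmbedding)

/-- The horizontal shear of the plane along the graph of a function of the height. -/
def hshear (f : ℝ → ℝ) (hf : Continuous f) : ℂ ≃ₜ ℂ where
  toFun z := ⟨z.re + f z.im, z.im⟩
  invFun z := ⟨z.re - f z.im, z.im⟩
  left_inv z := by simp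
  right_inv z := by simp
  continuous_toFun := continuous_complex_mk (by fun_prop) (by fun_prop)
  continuous_invFun := continuous_complex_mk (by fun_prop) (by fun_prop)

/-- The vertical shear of the plane along the graph of a function. -/
def vshear (f : ℝ → ℝ) (hf : Continuous f) : ℂ ≃ₜ ℂ where
  toFun z := ⟨z.re, z.im + f z.re⟩
  invFun z := ⟨z.re, z.im - f z.re⟩
  left_inv z := by simp
  right_inv z := by simp
  continuous_toFun := continuous_complex_mk (by fun_prop) (by fun_prop)
  continuous_invFun := continuous_complex_mk (by fun_prop) (by fun_prop)

/-- An open embedding factors through every open embedding with a larger range. -/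
lemma exists_isOpenEmbedding_comp_eq {X Y Z : Type*} [TopologicalSpace X] [TopologicalSpace Y]
    [TopologicalSpace Z] {g : Y → Z} {r : X → Z} (hg : IsOpenEmbedding g) (hr : IsOpenEmbedding r)
    (h : range r ⊆ range g) : ∃ e : X → Y, IsOpenEmbedding e ∧ g ∘ e = r := by
  choose e he using fun x => h (mem_range_self x)
  have hge : g ∘ e = r := funext he
  exact ⟨e, IsOpenEmbedding.of_comp e hg (hge ▸ hr), hge⟩

/-- The dilation of the plane by a nonzero factor with a given centre. -/
def dilation (c : ℂ) (t : ℝ) (ht : t ≠ 0) : ℂ ≃ₜ ℂ where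
  toFun z := c + t * (z - c)
  invFun z := c + (z - c) / t
  left_inv z := by
    have : (t : ℂ) ≠ 0 := by exact_mod_cast ht
    field_simp; ring
  right_inv z := by
    have : (t : ℂ) ≠ 0 := by exact_mod_cast ht
    field_simp; ring
  continuous_toFun := by fun_prop
  continuous_invFun := by fun_prop

/-- An embedding of the plane that is the identity near some point is isotopic to the identity, by
conjugating it with dilations; so it does not change the sign of a disk. -/
lemma SurfaceOrientation.comp_mem_positive {F : Type*} [TopologicalSpace F]
    (ω : SurfaceOrientation F) {h : ℂ → F} (hh : h ∈ ω.positive) {e : ℂ → ℂ}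
    (he : IsOpenEmbedding e) {c : ℂ} (hc : ∀ᶠ z in 𝓝 c, e z = z) : h ∘ e ∈ ω.positive := by
  have hho := ω.isOpenEmbedding h hh
  let G : unitInterval → ℂ → ℂ := fun t z =>
    if (t : ℝ) = 0 then z else c + (e (c + (t : ℝ) * (z - c)) - c) / (t : ℝ)
  have hG : Continuous fun x : unitInterval × ℂ => G x.1 x.2 := by
    rw [continuous_iff_continuousAt]
    rintro ⟨t, z⟩
    by_cases ht : (t : ℝ) = 0
    · have h1 : Tendsto (fun x : unitInterval × ℂ => c + ((x.1 : ℝ) : ℂ) * (x.2 - c)) (𝓝 (t, z))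
          (𝓝 c) := by
        have : Continuous fun x : unitInterval × ℂ => c + ((x.1 : ℝ) : ℂ) * (x.2 - c) := by
          fun_prop
        simpa [ht] using this.tendsto (t, z)
      have h2 : (fun x : unitInterval × ℂ => G x.1 x.2) =ᶠ[𝓝 (t, z)] fun x => x.2 := by
        filter_upwards [h1.eventually hc] with x hx
        by_cases hx0 : (x.1 : ℝ) = 0
        · simp only [G, if_pos hx0]
        · have : ((x.1 : ℝ) : ℂ) ≠ 0 := by exact_mod_cast hx0
          simp only [G, hx0, if_false, hx]
          field_simp
          ring
      exact (continuousAt_snd).congr h2.symm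
    · have h2 : (fun x : unitInterval × ℂ => G x.1 x.2) =ᶠ[𝓝 (t, z)]
          fun x => c + (e (c + ((x.1 : ℝ) : ℂ) * (x.2 - c)) - c) / ((x.1 : ℝ) : ℂ) := by
        have : ∀ᶠ x : unitInterval × ℂ in 𝓝 (t, z), (x.1 : ℝ) ≠ 0 :=
          (Continuous.continuousAt (by fun_prop)).eventually_ne ht
        filter_upwards [this] with x hx
        simp only [G, if_neg hx]
      refine ContinuousAt.congr ?_ h2.symm
      have h3 : ContinuousAt (fun x : unitInterval × ℂ =>
          e (c + ((x.1 : ℝ) : ℂ) * (x.2 - c))) (t, z) :=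
        (he.continuous.comp (by fun_prop)).continuousAt
      have h4 : ContinuousAt (fun x : unitInterval × ℂ => ((x.1 : ℝ) : ℂ)) (t, z) :=
        Continuous.continuousAt (by fun_prop)
      exact continuousAt_const.add ((h3.sub continuousAt_const).div h4 (by exact_mod_cast ht))
  have hGo : ∀ t, IsOpenEmbedding (G t) := by
    intro t
    by_cases ht : (t : ℝ) = 0
    · have : G t = id := by ext1 z; simp only [G, if_pos ht, id]
      rw [this]; exact IsOpenEmbedding.id
    · have : G t = (dilation c t ht).symm ∘ e ∘ dilation c t ht := by
        ext1 z; simp only [G, ht, if_false]; rfl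
      rw [this]
      exact (dilation c t ht).symm.isOpenEmbedding.comp
        (he.comp (dilation c t ht).isOpenEmbedding)
  have h0 : (fun z => h (G 0 z)) = h := by ext1 z; simp [G]
  have h1 : (fun z => h (G 1 z)) = h ∘ e := by ext1 z; simp [G]
  rw [← h1]
  exact ω.isotopy (fun t z => h (G t z)) (hho.continuous.comp hG) (fun t => hho.comp (hGo t))
    (by rwa [h0])

/-! ### Pull-backs of diagrams -/

section Germs

variable {X Y : Type*} [TopologicalSpace X] [TopologicalSpace Y] {f : X → Y}

lemma comap_nhdsWithin_of_isOpenEmbedding (hf : IsOpenEmbedding f) (S : Set Y) (x : X) :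
    Filter.comap f (𝓝[S] (f x)) = 𝓝[f ⁻¹' S] x := by
  rw [nhdsWithin, Filter.comap_inf, ← hf.nhds_eq_comap, comap_principal, nhdsWithin]

/-- A germ at a point of an open subset is determined by its restriction to the subset. -/
lemma germ_eq_of_comap_eq (hf : IsOpenEmbedding f) {x : X} {l l' : Filter Y} (hl : l ≤ 𝓝 (f x))
    (hl' : l' ≤ 𝓝 (f x)) (h : Filter.comap f l = Filter.comap f l') : l = l' := by
  have hr : range f ∈ 𝓝 (f x) := hf.isOpen_range.mem_nhds (mem_range_self x)
  rw [← map_comap_of_mem (hl hr), h, map_comap_of_mem (hl' hr)]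

/-- An embedding that is the identity near a point does not change the germs at this point. -/
lemma comap_germ_eq_self {f : X → X} (hf : IsOpenEmbedding f) {x : X}
    (hx : ∀ᶠ y in 𝓝 x, f y = y) {l : Filter X} (hl : l ≤ 𝓝 x) : Filter.comap f l = l := by
  have h : Filter.map f l = l :=
    (Filter.map_congr (m₂ := id) (hx.filter_mono hl)).trans Filter.map_id
  conv_lhs => rw [← h]
  exact comap_map hf.injective

end Germs

lemma PreDiagram.comap_comap {D E F : Type*} (T : PreDiagram F) (g : E → F) (f : D → E) :
    (T.comap g).comap f = T.comap (g ∘ f) := by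
  ext1
  · rfl
  · funext z; exact Filter.comap_comap
  · funext z; exact Filter.comap_comap

lemma HasGerms.comap {X Y : Type*} [TopologicalSpace X] [TopologicalSpace Y] {f : X → Y}
    {T : PreDiagram Y} (h : HasGerms T) (hf : IsOpenEmbedding f) : HasGerms (T.comap f) := by
  refine ⟨fun p => ?_, fun p hp => ?_⟩
  · rw [hf.nhds_eq_comap]
    exact ⟨Filter.comap_mono (h.1 _).1, Filter.comap_mono (h.1 _).2⟩
  · obtain ⟨h1, h2⟩ := h.2 (f p) hp
    exact ⟨by simp [PreDiagram.comap, h1], by simp [PreDiagram.comap, h2]⟩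

/-- The local models look the same at all scales. -/
lemma model_comap_coordMap {p : ℝ → ℝ} (hp : IsOpenEmbedding p) (hm : StrictMono p) (h0 : p 0 = 0)
    {S : Set ℂ} (hS : S = axis ∨ S = cross) (c o : Bool) :
    (model S c o).comap (coordMap p p) = model S c o := by
  have hinj : ∀ x, p x = 0 ↔ x = 0 := fun x => by
    rw [← h0]; exact hm.injective.eq_iff.trans (by rw [h0])
  have ho := isOpenEmbedding_coordMap hp hp
  have hz : ∀ z, coordMap p p z = 0 ↔ z = 0 := fun z => by
    simp [coordMap, Complex.ext_iff, hinj]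
  have hax : coordMap p p ⁻¹' axis = axis := by ext z; simp [axis, coordMap, hinj]
  have hSS : coordMap p p ⁻¹' S = S := by
    rcases hS with rfl | rfl
    · exact hax
    · ext z; simp [cross, coordMap, hinj]
  have hmem : ∀ z, coordMap p p z ∈ S ↔ z ∈ S := fun z => by
    rw [← mem_preimage, hSS]
  ext1
  · exact hSS
  · funext z
    simp only [PreDiagram.comap, model, hz]
    split_ifs with h
    · have := comap_nhdsWithin_of_isOpenEmbedding ho axis 0
      rwa [(hz 0).2 rfl, hax] at this
    · simp
  · funext z
    simp only [PreDiagram.comap, model]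
    by_cases hzS : o = true ∧ z ∈ S
    · rw [if_pos hzS, if_pos ⟨hzS.1, (hmem z).2 hzS.2⟩, comap_nhdsWithin_of_isOpenEmbedding ho]
      congr 1
      ext w
      refine (and_congr_left' (hmem w)).trans (and_congr_right fun hw => ?_)
      have hlt : ∀ a b, p a < p b ↔ a < b := fun a b => hm.lt_iff_lt
      have hz := hzS.2
      rcases hS with rfl | rfl
      · have hw : w.im = 0 := hw
        have hz : z.im = 0 := hz
        simp [coordMap, hw, hz, h0, hlt]
      · rcases hw with hw | hw <;> rcases hz with hz | hz <;> simp [coordMap, hw, hz, h0, hlt]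
    · rw [if_neg hzS, if_neg fun h => hzS ⟨h.1, (hmem z).1 h.2⟩, Filter.comap_bot]

/-- Every neighbourhood of the origin contains the image of a scaling map of the plane. -/
lemma exists_scaling {U : Set ℂ} (hU : U ∈ 𝓝 0) : ∃ p : ℝ → ℝ, StrictMono p ∧ Continuous p ∧
    p 0 = 0 ∧ ∀ z, coordMap p p z ∈ U := by
  obtain ⟨ε, hε, hb⟩ := Metric.mem_nhds_iff.1 hU
  have hd : ∀ x : ℝ, 0 < 1 + |x| := fun x => by positivity
  have hlt : ∀ x : ℝ, |ε / 2 * (x / (1 + |x|))| < ε / 2 := fun x => by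
    rw [abs_mul, abs_div x, abs_of_pos (hd x), abs_of_pos (half_pos hε)]
    have : |x| / (1 + |x|) < 1 := (div_lt_one (hd x)).2 (by linarith)
    nlinarith
  refine ⟨fun x => ε / 2 * (x / (1 + |x|)), ?_, ?_, by simp, fun z => hb ?_⟩
  · intro x y hxy
    refine mul_lt_mul_of_pos_left ?_ (half_pos hε)
    rw [div_lt_div_iff₀ (hd x) (hd y)]
    rcases abs_cases x with ⟨hx, hx'⟩ | ⟨hx, hx'⟩ <;> rcases abs_cases y with ⟨hy, hy'⟩ | ⟨hy, hy'⟩ <;>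
      rw [hx, hy] <;> nlinarith
  · exact continuous_const.mul (continuous_id.div (by fun_prop) fun x => (hd x).ne')
  · rw [mem_ball_zero_iff]
    refine (Complex.norm_le_abs_re_add_abs_im _).trans_lt ?_
    have h1 := hlt z.re
    have h2 := hlt z.im
    simp only [coordMap]
    linarith

/-- A regular point has charts in all of its neighbourhoods. -/
lemma RegularAt.exists_chart {F : Type*} [TopologicalSpace F] {k : Kind} {o : Bool}
    {T : PreDiagram F} {p : F} (h : RegularAt k o T p) {U : Set F} (hU : U ∈ 𝓝 p) :
    ∃ ψ : ℂ → F, IsOpenEmbedding ψ ∧ ψ 0 = p ∧ range ψ ⊆ U ∧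
    (T.comap ψ = model axis false o ∨ T.comap ψ = model cross true o ∨
      (k ≠ Kind.classical ∧ T.comap ψ = model cross false o)) := by
  obtain ⟨ψ, hψ, rfl, hm⟩ := h
  obtain ⟨p, hp, hpc, hp0, hpU⟩ := exists_scaling (hψ.continuous.continuousAt.preimage_mem_nhds hU)
  have hpo := isOpenEmbedding_of_strictMono hp hpc
  refine ⟨ψ ∘ coordMap p p, hψ.comp (isOpenEmbedding_coordMap hpo hpo), ?_, ?_, ?_⟩
  · have : coordMap p p 0 = 0 := by simp [coordMap, hp0, Complex.ext_iff]
    simp [this]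
  · rintro _ ⟨z, rfl⟩; exact hpU z
  · simp only [← PreDiagram.comap_comap]
    rcases hm with hm | hm | ⟨hk, hm⟩ <;>
      simp [model_comap_coordMap hpo hp hp0, *]

lemma RegularAt.comap {E F : Type*} [TopologicalSpace E] [TopologicalSpace F] {k : Kind} {o : Bool}
    {T : PreDiagram F} {g : E → F} (hg : IsOpenEmbedding g) {z : E} (h : RegularAt k o T (g z)) :
    RegularAt k o (T.comap g) z := by
  obtain ⟨ψ, hψ, h0, hr, hm⟩ := h.exists_chart (hg.isOpen_range.mem_nhds (mem_range_self z))
  obtain ⟨e, he, rfl⟩ := exists_isOpenEmbedding_comp_eq hg hψ hr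
  exact ⟨e, he, hg.injective h0, by simpa only [PreDiagram.comap_comap] using hm⟩

/-! ### Tangles along the rays -/

/-- The germ at `z` of the part of the vertical line through `z` that lies above `z` (for `ε > 0`)
or below `z` (for `ε < 0`). -/
def sideGerm (ε : ℝ) (z : ℂ) : Filter ℂ := 𝓝[{w | w.re = z.re ∧ 0 < ε * (w.im - z.im)}] z

lemma sideGerm_le_nhds (ε : ℝ) (z : ℂ) : sideGerm ε z ≤ 𝓝 z := nhdsWithin_le_nhds

lemma sideGerm_one_ne_sideGerm_neg_one (z : ℂ) : sideGerm 1 z ≠ sideGerm (-1) z := by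
  intro h
  have h1 : sideGerm 1 z = ⊥ := by
    rw [← inf_idem (sideGerm 1 z)]
    conv_lhs => enter [2]; rw [h]
    rw [sideGerm, sideGerm, ← nhdsWithin_inter, ← nhdsWithin_empty z]
    congr 1
    refine eq_empty_of_forall_notMem fun w ⟨h1, h2⟩ => ?_
    linarith [h1.2, h2.2]
  rw [sideGerm, ← not_neBot, ← mem_closure_iff_nhdsWithin_neBot, Metric.mem_closure_iff] at h1
  refine h1 fun δ hδ => ⟨⟨z.re, z.im + δ / 2⟩, by simpa using hδ, ?_⟩
  have : z - ⟨z.re, z.im + δ / 2⟩ = -(((δ / 2 : ℝ) : ℂ) * Complex.I) := by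
    apply Complex.ext <;> simp
  rw [dist_eq_norm, this, norm_neg, norm_mul, Complex.norm_I, mul_one, Complex.norm_real,
    Real.norm_of_nonneg (by positivity)]
  linarith

/-- Near a regular point, a diagram whose graph is a vertical line has no crossings, and its
orientation is constant. A crossing is impossible because the four half-strands of the local model
would be disjoint arcs that leave the same point of a line. -/
lemma RegularAt.germs_of_vertical {k : Kind} {o : Bool} {T : PreDiagram ℂ} (hT : HasGerms T) {p : ℂ}
    (h : RegularAt k o T p) (hv : ∀ᶠ w in 𝓝 p, w ∈ T.carrier ↔ w.re = p.re) :
    T.overpass p = ⊥ ∧ ∃ ε : ℝ, (ε = 1 ∨ ε = -1) ∧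
      ∀ᶠ w in 𝓝 p, w.re = p.re → T.fwd w = if o = true then sideGerm ε w else ⊥ := by
  obtain ⟨ψ, hψ, rfl, hr, hm⟩ := h.exists_chart hv
  have hcar : ∀ z, ψ z ∈ T.carrier ↔ (ψ z).re = (ψ 0).re := fun z => hr (mem_range_self z)
  -- The height along the horizontal axis of the chart.
  set u : ℝ → ℝ := fun t => (ψ t).im with hu
  have huc : Continuous u := by
    have := hψ.continuous
    fun_prop
  have key : ∀ S : Set ℂ, ψ ⁻¹' T.carrier = S → ∀ z ∈ S, (ψ z).re = (ψ 0).re :=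
    fun S hS z hz => (hcar z).1 (by rwa [← hS] at hz)
  have uinj : (∀ z ∈ axis, (ψ z).re = (ψ 0).re) → Function.Injective u := fun hax s t hst => by
    have : ψ s = ψ t := Complex.ext ((hax s (by simp [axis])).trans (hax t (by simp [axis])).symm) hst
    exact_mod_cast hψ.injective this
  have hcross : ∀ c, T.comap ψ ≠ model cross c o := by
    intro c hc
    have hre := key cross (congrArg PreDiagram.carrier hc)
    have hui := uinj fun z hz => hre z (Or.inr hz)
    have hv : Continuous fun t : ℝ => (ψ (t * Complex.I)).im := by
      have := hψ.continuous
      fun_prop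
    -- The vertical arms of the cross start at a height in the open range of `u`.
    have hev : ∀ᶠ t : ℝ in 𝓝 0, (ψ (t * Complex.I)).im ∈ range u :=
      hv.continuousAt.eventually_mem ((isOpen_range_of_injective huc hui).mem_nhds
        ⟨0, by simp [hu]⟩)
    obtain ⟨t, ⟨s, hs⟩, ht⟩ :=
      ((hev.filter_mono nhdsWithin_le_nhds).and (self_mem_nhdsWithin (s := {0}ᶜ))).exists
    have h2 : ψ s = ψ (t * Complex.I) := Complex.ext
      ((hre _ (Or.inr (by simp))).trans (hre _ (Or.inl (by simp))).symm) hs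
    have h3 := congrArg Complex.im (hψ.injective h2)
    simp at h3
    exact ht h3.symm
  have hax : T.comap ψ = model axis false o := by
    rcases hm with hm | hm | ⟨-, hm⟩
    · exact hm
    · exact absurd hm (hcross _)
    · exact absurd hm (hcross _)
  have hre := key axis (congrArg PreDiagram.carrier hax)
  have hui := uinj hre
  have hof : ∀ z, Filter.comap ψ (T.overpass (ψ z)) = ⊥ := fun z => by
    have := congrFun (congrArg PreDiagram.overpass hax) z
    simpa [PreDiagram.comap, model] using this
  refine ⟨germ_eq_of_comap_eq hψ (hT.1 _).1 bot_le (by rw [hof, Filter.comap_bot]), ?_⟩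
  obtain ⟨ε, hε, hεu⟩ : ∃ ε : ℝ, (ε = 1 ∨ ε = -1) ∧ ∀ s t, 0 < ε * (u t - u s) ↔ s < t := by
    rcases huc.strictMono_of_inj hui with hm | hm
    · exact ⟨1, Or.inl rfl, fun s t => by rw [one_mul, sub_pos, hm.lt_iff_lt]⟩
    · exact ⟨-1, Or.inr rfl, fun s t => by rw [neg_one_mul, neg_sub, sub_pos, hm.lt_iff_gt]⟩
  refine ⟨ε, hε, ?_⟩
  filter_upwards [hψ.isOpen_range.mem_nhds (mem_range_self 0)]
  rintro _ ⟨z, rfl⟩ hz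
  have hzc : ψ z ∈ T.carrier := (hcar z).2 hz
  have hza : z ∈ axis := by
    have : ψ ⁻¹' T.carrier = axis := congrArg PreDiagram.carrier hax
    rwa [← this]
  have hf : Filter.comap ψ (T.fwd (ψ z)) = (model axis false o).fwd z :=
    congrFun (congrArg PreDiagram.fwd hax) z
  have hofre : ∀ w ∈ axis, ψ w = ψ (w.re : ℂ) := fun w hw => by
    congr 1
    exact Complex.ext (by simp) (by simpa [axis] using hw)
  split_ifs with ho
  · refine germ_eq_of_comap_eq hψ (hT.1 _).2 (sideGerm_le_nhds _ _) ?_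
    rw [hf, sideGerm, comap_nhdsWithin_of_isOpenEmbedding hψ]
    simp only [model]
    rw [if_pos ⟨ho, hza⟩]
    congr 1
    ext w
    have hwa : w ∈ axis ↔ (ψ w).re = (ψ z).re := by
      rw [hz, ← hcar]
      have : ψ ⁻¹' T.carrier = axis := congrArg PreDiagram.carrier hax
      rw [← this]; rfl
    refine (and_congr_left' hwa).trans (and_congr_right fun hw => ?_)
    have hw := hwa.2 hw
    rw [hofre w hw, hofre z hza]
    have h1 : z.im = 0 := hza
    have h2 : w.im = 0 := hw
    rw [h1, h2, add_zero, add_zero]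
    exact (hεu z.re w.re).symm
  · refine germ_eq_of_comap_eq hψ (hT.1 _).2 bot_le ?_
    rw [hf, Filter.comap_bot]
    simp [model, ho]

/-- Above the standard disk, a tangle coincides with the rays near each of its points. -/
lemma IsTangle.eventually_mem_carrier_iff {k : Kind} {o : Bool} {n : ℕ} {T : PreDiagram ℂ}
    (hT : IsTangle k o n T) {z : ℂ} (hz : 0 ≤ z.im) :
    ∀ᶠ w in 𝓝 z, w ∈ T.carrier ↔ w ∈ rays n := by
  obtain ⟨-, -, -, K, hK, hKb, hKr⟩ := hT
  have : z ∉ K := fun h => (hKb h).2.2.2.not_ge hz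
  filter_upwards [hK.isClosed.isOpen_compl.mem_nhds this] with w hw using hKr w hw

lemma eventually_mem_rays_iff {n : ℕ} {z : ℂ} (hz : 0 ≤ z.im) (hr : z ∈ rays n) :
    ∀ᶠ w in 𝓝 z, w ∈ rays n ↔ w.re = z.re := by
  obtain ⟨⟨j, hj1, hj2, hj⟩, -⟩ := hr
  have h1 : ∀ᶠ w : ℂ in 𝓝 z, w.im ∈ Ioi (-(1 / 2) : ℝ) :=
    Complex.continuous_im.continuousAt.eventually_mem (Ioi_mem_nhds (by linarith))
  have h2 : ∀ᶠ w : ℂ in 𝓝 z, w.re ∈ Ioo ((j : ℝ) - 1) (j + 1) :=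
    Complex.continuous_re.continuousAt.eventually_mem
      (Ioo_mem_nhds (by linarith) (by linarith))
  filter_upwards [h1, h2] with w hw1 hw2
  constructor
  · rintro ⟨⟨i, -, -, hi⟩, -⟩
    rw [hi] at hw2 ⊢
    have h3 : (j : ℝ) < i + 1 := by linarith [hw2.1]
    have h4 : (i : ℝ) < j + 1 := hw2.2
    have : i = j := by
      have h3 : j < i + 1 := by exact_mod_cast h3
      have h4 : i < j + 1 := by exact_mod_cast h4
      omega
    rw [this, hj]
  · intro h
    exact ⟨⟨j, hj1, hj2, h.trans hj⟩, hw1⟩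

/-- Above the standard disk, the strands of a tangle have no crossings, and each of them is either
directed upwards or directed downwards. -/
lemma IsTangle.germs_on_rays {k : Kind} {o : Bool} {n : ℕ} {T : PreDiagram ℂ}
    (hT : IsTangle k o n T) :
    (∀ z ∈ rays n, 0 ≤ z.im → T.overpass z = ⊥) ∧
    ∀ z ∈ rays n, 0 ≤ z.im → ∃ ε : ℝ, (ε = 1 ∨ ε = -1) ∧ ∀ w : ℂ, 0 ≤ w.im → w.re = z.re →
      T.fwd w = if o = true then sideGerm ε w else ⊥ := by
  have key : ∀ z ∈ rays n, 0 ≤ z.im → T.overpass z = ⊥ ∧ ∃ ε : ℝ, (ε = 1 ∨ ε = -1) ∧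
      ∀ᶠ w in 𝓝 z, w.re = z.re → T.fwd w = if o = true then sideGerm ε w else ⊥ := by
    intro z hz h0
    have h1 := hT.eventually_mem_carrier_iff h0
    refine (hT.2.2.1 z (h1.self_of_nhds.2 hz)).germs_of_vertical hT.2.1 ?_
    filter_upwards [h1, eventually_mem_rays_iff h0 hz] with w h2 h3 using h2.trans h3
  refine ⟨fun z hz h0 => (key z hz h0).1, fun z hz h0 => ?_⟩
  have hray : ∀ w : ℂ, 0 ≤ w.im → w.re = z.re → w ∈ rays n := fun w hw hre =>
    ⟨by rw [hre]; exact hz.1, by linarith⟩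
  cases o with
  | false =>
    refine ⟨1, Or.inl rfl, fun w hw hre => ?_⟩
    obtain ⟨-, ε, -, h⟩ := key w (hray w hw hre) hw
    simpa using h.self_of_nhds rfl
  | true =>
    simp only [if_true] at key ⊢
    -- Connectedness of the half-line: being directed upwards is a locally constant property.
    let P : Ici (0 : ℝ) → Prop := fun y => T.fwd ⟨z.re, y⟩ = sideGerm 1 ⟨z.re, y⟩
    have hloc : ∀ y : Ici (0 : ℝ), ∃ ε : ℝ, (ε = 1 ∨ ε = -1) ∧
        ∀ᶠ x : Ici (0 : ℝ) in 𝓝 y, T.fwd ⟨z.re, x⟩ = sideGerm ε ⟨z.re, x⟩ := by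
      intro y
      obtain ⟨-, ε, hε, h⟩ := key ⟨z.re, y⟩ (hray _ y.2 rfl) y.2
      refine ⟨ε, hε, ?_⟩
      have hc : Continuous fun x : Ici (0 : ℝ) => (⟨z.re, x⟩ : ℂ) :=
        continuous_complex_mk continuous_const continuous_subtype_val
      filter_upwards [hc.continuousAt.eventually h] with x hx using hx rfl
    have hP : IsLocallyConstant P := by
      rw [IsLocallyConstant.iff_eventually_eq]
      intro y
      obtain ⟨ε, rfl | rfl, h⟩ := hloc y
      · have h' := h.self_of_nhds
        filter_upwards [h] with x hx
        simp only [P, hx, h']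
      · have h' := h.self_of_nhds
        filter_upwards [h] with x hx
        simp only [P, hx, h', eq_iff_iff]
        exact iff_of_false (sideGerm_one_ne_sideGerm_neg_one _).symm
          (sideGerm_one_ne_sideGerm_neg_one _).symm
    have hpc : PreconnectedSpace (Ici (0 : ℝ)) := Subtype.preconnectedSpace isPreconnected_Ici
    by_cases h1 : P ⟨0, self_mem_Ici⟩
    · refine ⟨1, Or.inl rfl, fun w hw hre => ?_⟩
      have : P ⟨w.im, hw⟩ := by rwa [hP.apply_eq_of_preconnectedSpace _ ⟨0, self_mem_Ici⟩]
      have hwe : w = ⟨z.re, w.im⟩ := Complex.ext hre rfl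
      rw [hwe]; exact this
    · refine ⟨-1, Or.inr rfl, fun w hw hre => ?_⟩
      have hn : ¬ P ⟨w.im, hw⟩ := by rwa [hP.apply_eq_of_preconnectedSpace _ ⟨0, self_mem_Ici⟩]
      have hwe : w = ⟨z.re, w.im⟩ := Complex.ext hre rfl
      obtain ⟨ε, rfl | rfl, h⟩ := hloc ⟨w.im, hw⟩
      · exact absurd h.self_of_nhds hn
      · rw [hwe]; exact h.self_of_nhds

/-- A map of the plane that fixes the lower half-plane and shortens the vertical half-lines above it
maps every tangle to itself. -/
lemma IsTangle.comap_coordMap_id {k : Kind} {o : Bool} {n : ℕ} {T : PreDiagram ℂ}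
    (hT : IsTangle k o n T) {s : ℝ → ℝ} (hs : StrictMono s) (hsc : Continuous s)
    (hs0 : ∀ y ≤ 0, s y = y) : T.comap (coordMap id s) = T := by
  have ho := isOpenEmbedding_coordMap IsOpenEmbedding.id (isOpenEmbedding_of_strictMono hs hsc)
  have hpos : ∀ z : ℂ, 0 ≤ z.im → 0 ≤ (coordMap id s z).im := fun z hz => by
    have := hs.monotone hz
    rwa [hs0 0 le_rfl] at this
  have hfix : ∀ z : ℂ, z.im < 0 → ∀ᶠ w in 𝓝 z, coordMap id s w = w := fun z hz => by
    have : ∀ᶠ w : ℂ in 𝓝 z, w.im ∈ Iio (0 : ℝ) :=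
      Complex.continuous_im.continuousAt.eventually_mem (Iio_mem_nhds hz)
    filter_upwards [this] with w hw
    exact Complex.ext rfl (hs0 _ (le_of_lt hw))
  have hrays : ∀ z : ℂ, 0 ≤ z.im → (coordMap id s z ∈ rays n ↔ z ∈ rays n) := fun z hz =>
    and_congr_right fun _ => iff_of_true (by linarith [hpos z hz]) (by linarith)
  have hcr : ∀ z : ℂ, 0 ≤ z.im → (z ∈ T.carrier ↔ z ∈ rays n) := fun z hz =>
    (hT.eventually_mem_carrier_iff hz).self_of_nhds
  have hcar : ∀ z : ℂ, 0 ≤ z.im → (coordMap id s z ∈ T.carrier ↔ z ∈ T.carrier) := fun z hz => by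
    rw [hcr z hz, hcr _ (hpos z hz), hrays z hz]
  obtain ⟨hover, hfwd⟩ := hT.germs_on_rays
  ext1
  · ext z
    rcases lt_or_ge z.im 0 with hz | hz
    · simp [PreDiagram.comap, (hfix z hz).self_of_nhds]
    · exact hcar z hz
  · funext z
    simp only [PreDiagram.comap]
    rcases lt_or_ge z.im 0 with hz | hz
    · rw [(hfix z hz).self_of_nhds]
      exact comap_germ_eq_self ho (hfix z hz) (hT.2.1.1 z).1
    · have hbot : ∀ w : ℂ, 0 ≤ w.im → T.overpass w = ⊥ := fun w hw => by
        by_cases hwc : w ∈ T.carrier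
        · exact hover w ((hcr w hw).1 hwc) hw
        · exact (hT.2.1.2 w hwc).1
      rw [hbot z hz, hbot _ (hpos z hz), Filter.comap_bot]
  · funext z
    simp only [PreDiagram.comap]
    rcases lt_or_ge z.im 0 with hz | hz
    · rw [(hfix z hz).self_of_nhds]
      exact comap_germ_eq_self ho (hfix z hz) (hT.2.1.1 z).2
    · by_cases hzc : z ∈ T.carrier
      · obtain ⟨ε, hε, h⟩ := hfwd z ((hcr z hz).1 hzc) hz
        rw [h z hz rfl, h (coordMap id s z) (hpos z hz) rfl]
        split_ifs
        · rw [sideGerm, comap_nhdsWithin_of_isOpenEmbedding ho, sideGerm]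
          congr 1
          ext w
          refine and_congr_right fun _ => ?_
          rcases hε with rfl | rfl <;> simp [coordMap, hs.lt_iff_lt]
        · exact Filter.comap_bot
      · rw [(hT.2.1.2 z hzc).2, (hT.2.1.2 _ (mt (hcar z hz).1 hzc)).2, Filter.comap_bot]

/-! ### Bending the last strand -/

/-- An increasing homeomorphism from the line to `(-∞, 1/4)` that fixes the negative numbers. -/
def squeeze (y : ℝ) : ℝ := y / (1 + 4 * max y 0)

lemma squeeze_of_nonpos {y : ℝ} (hy : y ≤ 0) : squeeze y = y := by simp [squeeze, hy]

lemma squeeze_of_nonneg {y : ℝ} (hy : 0 ≤ y) : squeeze y = y / (1 + 4 * y) := by simp [squeeze, hy]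

lemma continuous_squeeze : Continuous squeeze :=
  continuous_id.div (by fun_prop) fun y => by positivity

lemma strictMono_squeeze : StrictMono squeeze := by
  intro x y h
  rcases le_total y 0 with hy | hy
  · rwa [squeeze_of_nonpos hy, squeeze_of_nonpos (h.le.trans hy)]
  rw [squeeze_of_nonneg hy]
  rcases le_or_gt 0 x with hx | hx
  · rw [squeeze_of_nonneg hx, div_lt_div_iff₀ (by positivity) (by positivity)]
    nlinarith
  · rw [squeeze_of_nonpos hx.le]
    exact hx.trans_le (by positivity)

lemma squeeze_lt (y : ℝ) : squeeze y < 1 / 4 := by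
  rcases le_total y 0 with hy | hy
  · rw [squeeze_of_nonpos hy]; linarith
  · rw [squeeze_of_nonneg hy, div_lt_div_iff₀ (by positivity) (by positivity)]; linarith

lemma exists_squeeze_eq {Y : ℝ} (hY : Y < 1 / 4) : ∃ y, squeeze y = Y := by
  rcases le_total Y 0 with h | h
  · exact ⟨Y, squeeze_of_nonpos h⟩
  · have : 0 < 1 - 4 * Y := by linarith
    refine ⟨Y / (1 - 4 * Y), ?_⟩
    have h1 : 1 + 4 * (Y / (1 - 4 * Y)) = 1 / (1 - 4 * Y) := by field_simp; ring
    rw [squeeze_of_nonneg (by positivity), h1, div_div_div_cancel_right₀ this.ne', div_one]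

/-- An increasing piecewise linear homeomorphism of the line that stretches `[0, 1]` to `[0, 6]`. -/
def stretch (u : ℝ) : ℝ := u + 5 * max 0 (min u 1)

lemma continuous_stretch : Continuous stretch := by unfold stretch; fun_prop

lemma strictMono_stretch : StrictMono stretch := fun x y h => by
  have : max 0 (min x 1) ≤ max 0 (min y 1) := by gcongr
  unfold stretch; linarith

lemma stretch_of_nonpos {u : ℝ} (hu : u ≤ 0) : stretch u = u := by
  rw [stretch, max_eq_left ((min_le_left _ _).trans hu)]; ring

lemma stretch_one : stretch 1 = 6 := by norm_num [stretch]

lemma stretch_two : stretch 2 = 7 := by norm_num [stretch]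

lemma exists_stretch_eq (X : ℝ) : ∃ u, stretch u = X := by
  rcases le_total X 0 with h | h
  · exact ⟨X, stretch_of_nonpos h⟩
  rcases le_total X 6 with h6 | h6
  · refine ⟨X / 6, ?_⟩
    rw [stretch, min_eq_left (by linarith), max_eq_right (by linarith)]; ring
  · refine ⟨X - 5, ?_⟩
    rw [stretch, min_eq_right (by linarith), max_eq_right (by linarith)]; ring

/-- The profile of the vertical shear in `bend`. -/
def rampUp (x : ℝ) : ℝ := 2 * max 0 (min (x - 2) (19 / 4))

/-- The profile of the second horizontal shear in `bend`. -/
def zigzag (t : ℝ) : ℝ := max (min t (2 - t)) (t - 33 / 2)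

lemma continuous_rampUp : Continuous rampUp := by unfold rampUp; fun_prop

lemma continuous_zigzag : Continuous zigzag := by unfold zigzag; fun_prop

/-- An open embedding of the plane onto the plane without a closed set that cuts the ray over `2n`.
It is the identity on the left part of the standard disk. The preimage of the ray over `2n`
consists of this ray and of a strand in the form of the letter U with the ends over `2n + 1` and
`2n + 2`, while the other rays are their own preimages.

In coordinates with origin `(2n, 0)`, it is a composition of the map `stretch × squeeze` and of
three shears of the plane. The shears alone would form a homeomorphism of the plane; the preimage
of the vertical axis under it is a zigzag of three vertical half-lines and segments, joined by a cap
and by a cup. The map `squeeze` cuts off the cap. -/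
def bend (n : ℕ) (z : ℂ) : ℂ :=
  hshear (fun t => 2 * n + zigzag t) (continuous_const.add continuous_zigzag)
    (vshear rampUp continuous_rampUp (hshear (fun y => -y) continuous_neg
      (coordMap (fun x => stretch (x - 2 * n)) squeeze z)))

lemma isOpenEmbedding_bend (n : ℕ) : IsOpenEmbedding (bend n) := by
  have h : IsOpenEmbedding (coordMap (fun x => stretch (x - 2 * n)) squeeze) :=
    isOpenEmbedding_coordMap
      (isOpenEmbedding_of_strictMono (fun x y h => strictMono_stretch (by linarith))
        (continuous_stretch.comp (by fun_prop)))
      (isOpenEmbedding_of_strictMono strictMono_squeeze continuous_squeeze)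
  exact (hshear _ _).isOpenEmbedding.comp ((vshear _ _).isOpenEmbedding.comp
    ((hshear _ _).isOpenEmbedding.comp h))

lemma bend_eq (n : ℕ) (z : ℂ) : bend n z =
    ⟨stretch (z.re - 2 * n) - squeeze z.im + (2 * n + zigzag (squeeze z.im +
        rampUp (stretch (z.re - 2 * n) - squeeze z.im))),
      squeeze z.im + rampUp (stretch (z.re - 2 * n) - squeeze z.im)⟩ := rfl

lemma rampUp_of_le {x : ℝ} (h : x ≤ 2) : rampUp x = 0 := by
  rw [rampUp, max_eq_left ((min_le_left _ _).trans (by linarith)), mul_zero]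

lemma rampUp_of_mem {x : ℝ} (h : 2 ≤ x) (h' : x ≤ 27 / 4) : rampUp x = 2 * (x - 2) := by
  rw [rampUp, min_eq_left (by linarith), max_eq_right (by linarith)]

lemma rampUp_of_ge {x : ℝ} (h : 27 / 4 ≤ x) : rampUp x = 19 / 2 := by
  rw [rampUp, min_eq_right (by linarith), max_eq_right (by linarith)]; ring

lemma rampUp_nonneg (x : ℝ) : 0 ≤ rampUp x := by unfold rampUp; positivity

lemma zigzag_of_le {t : ℝ} (h : t ≤ 1) : zigzag t = t := by
  rw [zigzag, min_eq_left (by linarith), max_eq_left (by linarith)]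

lemma zigzag_of_mem {t : ℝ} (h : 1 ≤ t) (h' : t ≤ 37 / 4) : zigzag t = 2 - t := by
  rw [zigzag, min_eq_right (by linarith), max_eq_left (by linarith)]

lemma zigzag_of_ge {t : ℝ} (h : 37 / 4 ≤ t) : zigzag t = t - 33 / 2 := by
  rw [zigzag, min_eq_right (by linarith), max_eq_right (by linarith)]

lemma bend_of_le {n : ℕ} {z : ℂ} (h0 : z.im ≤ 0) (h : stretch (z.re - 2 * n) - z.im ≤ 2) :
    bend n z = ⟨stretch (z.re - 2 * n) + 2 * n, z.im⟩ := by
  rw [bend_eq, squeeze_of_nonpos h0, rampUp_of_le h, add_zero, zigzag_of_le (by linarith)]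
  exact Complex.ext (by simp only; ring) rfl

/-- Points below height `1/4` are outside of the closed set that is cut out. -/
lemma mem_range_bend {n : ℕ} {z : ℂ} (hz : z.im < 1 / 4) : z ∈ range (bend n) := by
  obtain ⟨y, hy⟩ := exists_squeeze_eq (Y := z.im - rampUp (z.re - 2 * n - z.im))
    (by linarith [rampUp_nonneg (z.re - 2 * n - z.im)])
  obtain ⟨u, hu⟩ := exists_stretch_eq (z.re - 2 * n - z.im + squeeze y)
  refine ⟨⟨u + 2 * n, y⟩, ?_⟩
  have h1 : stretch (u + 2 * n - 2 * n) - squeeze y = z.re - 2 * n - z.im := by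
    rw [add_sub_cancel_right, hu]; ring
  rw [bend_eq]
  simp only [h1]
  rw [hy, sub_add_cancel, zigzag_of_le (by linarith)]
  exact Complex.ext (by simp) rfl

lemma box_subset_image_bend (n : ℕ) : box n ⊆ bend n '' box (n + 1) := by
  rintro z ⟨h1, h2, h3, h4⟩
  obtain ⟨u, hu⟩ := exists_stretch_eq (z.re - 2 * n)
  have hu1 : u < 1 := strictMono_stretch.lt_iff_lt.1 (by rw [hu, stretch_one]; linarith)
  have hu2 : -(2 * n) < u := strictMono_stretch.lt_iff_lt.1 (by
    rw [hu, stretch_of_nonpos (by simp)]; linarith)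
  refine ⟨⟨u + 2 * n, z.im⟩, ⟨?_, ?_, h3, h4⟩, ?_⟩
  · simp only; linarith
  · simp only; push_cast; linarith
  · refine (bend_of_le (z := ⟨u + 2 * n, z.im⟩) h4.le ?_).trans ?_
    · simp only [add_sub_cancel_right, hu]; linarith
    · simp [hu]

/-- Near the interior point `(2n - 1/2, -1/2)` of the standard disk, `bend n` is the identity. -/
lemma eventually_bend_eq (n : ℕ) : ∀ᶠ z in 𝓝 (⟨2 * n - 1 / 2, -(1 / 2)⟩ : ℂ), bend n z = z := by
  have h1 : ∀ᶠ z : ℂ in 𝓝 ⟨2 * n - 1 / 2, -(1 / 2)⟩, z.im ∈ Ioo (-1 : ℝ) 0 :=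
    Complex.continuous_im.continuousAt.eventually_mem (Ioo_mem_nhds (by norm_num) (by norm_num))
  have h2 : ∀ᶠ z : ℂ in 𝓝 ⟨2 * n - 1 / 2, -(1 / 2)⟩, z.re ∈ Iio (2 * n : ℝ) :=
    Complex.continuous_re.continuousAt.eventually_mem (Iio_mem_nhds (by simp))
  filter_upwards [h1, h2] with z hz1 hz2
  have hs : stretch (z.re - 2 * n) = z.re - 2 * n :=
    stretch_of_nonpos (by linarith [mem_Iio.1 hz2])
  rw [bend_of_le hz1.2.le (by rw [hs]; linarith [hz1.1, mem_Iio.1 hz2]), hs]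
  exact Complex.ext (by simp) rfl

/-- The part of the standard disk that contains the bottom of the strand added by `bend`. -/
def cupRegion (n : ℕ) : Set ℂ := Icc (2 * n + 1 : ℝ) (2 * n + 2) ×ℂ Icc (-(3 / 4) : ℝ) (-(1 / 4))

/-- The computation of the zigzag: the vertical line at distance `m` to the left of the origin pulls
back to itself, and for `m = 0` also to two further vertical lines and to a slanted segment that
joins them; `hX` excludes a rectangle around this segment. Here `X` and `Y` are the coordinates after
`stretch × squeeze`. -/
lemma shears_preimage_vertical {X Y : ℝ} (hY : Y < 1 / 4) (m : ℕ)
    (hX : ¬ (6 ≤ X ∧ X ≤ 7 ∧ -(3 / 4) ≤ Y ∧ Y ≤ -(1 / 4))) :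
    X - Y + zigzag (Y + rampUp (X - Y)) = -m ∧ -(1 / 2) < Y + rampUp (X - Y) ↔
      (X = -m ∨ m = 0 ∧ (X = 6 ∨ X = 7)) ∧ -(1 / 2) < Y := by
  have hm : m = 0 ∨ (1 : ℝ) ≤ m := by
    rcases Nat.eq_zero_or_pos m with h | h
    · exact Or.inl h
    · exact Or.inr (by exact_mod_cast h)
  have hm0 : (0 : ℝ) ≤ m := m.cast_nonneg
  rcases le_total (X - Y) 2 with h1 | h1
  · rw [rampUp_of_le h1, add_zero, zigzag_of_le (by linarith), sub_add_cancel]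
    refine and_congr_left fun hy => ⟨Or.inl, ?_⟩
    rintro (h | ⟨-, h | h⟩)
    · exact h
    · linarith
    · linarith
  -- For `m ≥ 1`, the further parts of the preimage lie above the height `1/4`.
  rcases le_total (X - Y) (27 / 4) with h2 | h2
  · rw [rampUp_of_mem h1 h2]
    rcases le_total (Y + 2 * (X - Y - 2)) 1 with h3 | h3
    · rw [zigzag_of_le h3]
      refine ⟨fun ⟨h, h'⟩ => by linarith, ?_⟩
      rintro ⟨h | ⟨-, h | h⟩, h'⟩ <;> linarith
    rcases le_total (Y + 2 * (X - Y - 2)) (37 / 4) with h4 | h4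
    · rw [zigzag_of_mem h3 h4]
      constructor
      · rintro ⟨h, -⟩
        rcases hm with rfl | hm
        · have h6 : X = 6 := by push_cast at h; linarith
          refine ⟨Or.inr ⟨rfl, Or.inl h6⟩, ?_⟩
          by_contra h5
          exact hX ⟨by linarith, by linarith, by linarith, by linarith⟩
        · linarith
      · rintro ⟨h | ⟨rfl, h | h⟩, h'⟩
        · linarith
        · push_cast; constructor <;> linarith
        · linarith
    · rw [zigzag_of_ge h4]
      refine ⟨fun ⟨h, h'⟩ => by rcases hm with rfl | hm <;> push_cast at * <;> linarith, ?_⟩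
      rintro ⟨h | ⟨-, h | h⟩, h'⟩ <;> linarith
  · rw [rampUp_of_ge h2]
    rcases le_total (Y + 19 / 2) 1 with h3 | h3
    · rw [zigzag_of_le h3]
      refine ⟨fun ⟨h, h'⟩ => by linarith, fun ⟨h, h'⟩ => by linarith⟩
    rcases le_total (Y + 19 / 2) (37 / 4) with h4 | h4
    · rw [zigzag_of_mem h3 h4]
      constructor
      · rintro ⟨h, -⟩
        rcases hm with rfl | hm
        · push_cast at h
          exact absurd ⟨by linarith, by linarith, by linarith, by linarith⟩ hX
        · linarith
      · rintro ⟨h | ⟨rfl, h | h⟩, h'⟩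
        · linarith
        · linarith
        · exact absurd ⟨by linarith, by linarith, by linarith, by linarith⟩ hX
    · rw [zigzag_of_ge h4]
      constructor
      · rintro ⟨h, -⟩
        rcases hm with rfl | hm
        · push_cast at h
          exact ⟨Or.inr ⟨rfl, Or.inr (by linarith)⟩, by linarith⟩
        · linarith
      · rintro ⟨h | ⟨rfl, h | h⟩, h'⟩
        · linarith
        · linarith
        · push_cast; constructor <;> linarith

lemma neg_half_lt_squeeze {y : ℝ} : -(1 / 2) < squeeze y ↔ -(1 / 2) < y := by
  conv_lhs => rw [← squeeze_of_nonpos (by norm_num : (-(1 / 2) : ℝ) ≤ 0)]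
  exact strictMono_squeeze.lt_iff_lt

/-- Outside of the cup region, the preimage of the rays consists of the rays of the next degree. -/
lemma bend_mem_rays_iff {n : ℕ} (hn : 1 ≤ n) {z : ℂ} (hz : z ∉ cupRegion n) :
    bend n z ∈ rays n ↔ z ∈ rays (n + 1) := by
  have hst : ∀ {a : ℝ} {b : ℝ}, stretch a = b → ∀ u, stretch u = b ↔ u = a := fun h u => by
    rw [← h]; exact strictMono_stretch.injective.eq_iff
  have h6 := hst stretch_one
  have h7 := hst stretch_two
  have hneg : ∀ (m : ℕ) (u : ℝ), stretch u = -m ↔ u = -m := fun m =>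
    hst (stretch_of_nonpos (by simp))
  have hX : ¬ (6 ≤ stretch (z.re - 2 * n) ∧ stretch (z.re - 2 * n) ≤ 7 ∧
      -(3 / 4) ≤ squeeze z.im ∧ squeeze z.im ≤ -(1 / 4)) := by
    rintro ⟨ha, hb, hc, hd⟩
    rw [← stretch_one, strictMono_stretch.le_iff_le] at ha
    rw [← stretch_two, strictMono_stretch.le_iff_le] at hb
    have e1 : squeeze (-(3 / 4)) = -(3 / 4) := squeeze_of_nonpos (by norm_num)
    have e2 : squeeze (-(1 / 4)) = -(1 / 4) := squeeze_of_nonpos (by norm_num)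
    rw [← e1, strictMono_squeeze.le_iff_le] at hc
    rw [← e2, strictMono_squeeze.le_iff_le] at hd
    exact hz ⟨⟨by linarith, by linarith⟩, hc, hd⟩
  have key := fun m => shears_preimage_vertical (squeeze_lt z.im) m hX
  simp only [hneg, h6, h7, neg_half_lt_squeeze] at key
  rw [bend_eq]
  simp only [rays, mem_ofPred_eq]
  constructor
  · rintro ⟨⟨j, hj1, hj2, hj⟩, him⟩
    have hc : ((2 * n - j : ℕ) : ℝ) = 2 * n - j := by rw [Nat.cast_sub hj2]; push_cast; rfl
    obtain ⟨h | ⟨h0, h | h⟩, him'⟩ := (key (2 * n - j)).1 ⟨by rw [hc]; linarith, him⟩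
    · exact ⟨⟨j, hj1, by omega, by rw [hc] at h; linarith⟩, him'⟩
    · exact ⟨⟨2 * n + 1, by omega, by omega, by push_cast; linarith⟩, him'⟩
    · exact ⟨⟨2 * n + 2, by omega, by omega, by push_cast; linarith⟩, him'⟩
  · rintro ⟨⟨j, hj1, hj2, hj⟩, him⟩
    rcases le_or_gt j (2 * n) with hjn | hjn
    · have hc : ((2 * n - j : ℕ) : ℝ) = 2 * n - j := by rw [Nat.cast_sub hjn]; push_cast; rfl
      obtain ⟨h, him'⟩ := (key (2 * n - j)).2 ⟨Or.inl (by rw [hc]; linarith), him⟩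
      exact ⟨⟨j, hj1, hjn, by rw [hc] at h; linarith⟩, him'⟩
    · have hj' : (j : ℝ) - 2 * n = 1 ∨ (j : ℝ) - 2 * n = 2 := by
        obtain rfl | rfl : j = 2 * n + 1 ∨ j = 2 * n + 2 := by omega
        · left; push_cast; ring
        · right; push_cast; ring
      obtain ⟨h, him'⟩ := (key 0).2 ⟨Or.inr ⟨rfl, by rwa [hj]⟩, him⟩
      exact ⟨⟨2 * n, by omega, le_rfl, by push_cast at h ⊢; linarith⟩, him'⟩

/-! ### Raising the degree of a move -/

lemma IsTangle.comap_bend {k : Kind} {o : Bool} {n : ℕ} (hn : 1 ≤ n) {T : PreDiagram ℂ}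
    (hT : IsTangle k o n T) : IsTangle k o (n + 1) (T.comap (bend n)) := by
  obtain ⟨hc, hg, hr, K, hK, hKb, hKr⟩ := hT
  have hb := isOpenEmbedding_bend n
  have hsub : bend n ⁻¹' K ⊆ box (n + 1) := fun z hz => by
    obtain ⟨w, hw, hwz⟩ := box_subset_image_bend n (hKb hz)
    rwa [← hb.injective hwz]
  refine ⟨hc.preimage hb.continuous, hg.comap hb, fun p hp => (hr _ hp).comap hb,
    bend n ⁻¹' K ∪ cupRegion n, ?_, union_subset hsub ?_, fun z hz => ?_⟩
  · refine (hb.isInducing.isCompact_preimage' hK ?_).union (isCompact_Icc.reProdIm isCompact_Icc)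
    exact fun z hz => mem_range_bend (by linarith [(hKb hz).2.2.2])
  · rintro z ⟨⟨h1, h2⟩, h3, h4⟩
    have : (0 : ℝ) ≤ n := n.cast_nonneg
    refine ⟨by linarith, by push_cast; linarith, by linarith, by linarith⟩
  · rw [mem_union, not_or] at hz
    exact (hKr _ hz.1).trans (bend_mem_rays_iff hn hz.2)

/-- The move of the next degree obtained from a move by adding a strand without crossings next to
the given tangles, realized as the pull-back of the move along `bend n`. -/
def LocalMove.raise {k : Kind} {o : Bool} {n : ℕ} (hn : 1 ≤ n) (M : LocalMove k o n) :
    LocalMove k o (n + 1) where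
  source := M.source.comap (bend n)
  target := M.target.comap (bend n)
  source_isTangle := M.source_isTangle.comap_bend hn
  target_isTangle := M.target_isTangle.comap_bend hn
  boundary_eq := fun z hz => by
    obtain ⟨h1, h2, h3⟩ := M.boundary_eq (bend n z) fun hb => hz (by
      obtain ⟨w, hw, hwz⟩ := box_subset_image_bend n hb
      rwa [← (isOpenEmbedding_bend n).injective hwz])
    exact ⟨h1, congrArg (Filter.comap (bend n)) h2, congrArg (Filter.comap (bend n)) h3⟩

/-- Inside of the standard disk of the raised move, the disk of the given move is the image of the
plane under an open embedding that is isotopic to the identity. -/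
lemma exists_bend_section (n : ℕ) : ∃ e : ℂ → ℂ, IsOpenEmbedding e ∧
    bend n ∘ e = coordMap id squeeze ∧
    ∀ᶠ z in 𝓝 (⟨2 * n - 1 / 2, -(1 / 2)⟩ : ℂ), e z = z := by
  have hb := isOpenEmbedding_bend n
  obtain ⟨e, he, hbe⟩ := exists_isOpenEmbedding_comp_eq hb
    (isOpenEmbedding_coordMap IsOpenEmbedding.id
      (isOpenEmbedding_of_strictMono strictMono_squeeze continuous_squeeze))
    (range_subset_iff.2 fun z => mem_range_bend (squeeze_lt z.im))
  refine ⟨e, he, hbe, ?_⟩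
  have h1 : ∀ᶠ z : ℂ in 𝓝 ⟨2 * n - 1 / 2, -(1 / 2)⟩, z.im ∈ Iio (0 : ℝ) :=
    Complex.continuous_im.continuousAt.eventually_mem (Iio_mem_nhds (by norm_num))
  filter_upwards [h1, eventually_bend_eq n] with z hz hbz
  refine hb.injective ?_
  rw [hbz]
  exact (congrFun hbe z).trans (Complex.ext rfl (squeeze_of_nonpos (le_of_lt hz)))

section Surface

variable {F : Type*} [TopologicalSpace F] [ChartedSpace (EuclideanHalfSpace 2) F]

/-- A move and the raised move have the same applications. A disk for the raised move is obtained
from a disk for the given move by bending it along the last strand, until it meets this strand a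
second time. A disk for the given move is a part of a disk for the raised move. -/
lemma applies_raise_iff (ω : SurfaceOrientation F) {k : Kind} {o : Bool} {n : ℕ} (hn : 1 ≤ n)
    (M : LocalMove k o n) {D D' : PreDiagram F} (hD : HasGerms D) (hD' : HasGerms D') :
    Applies ω (M.raise hn) D D' ↔ Applies ω M D D' := by
  have hb := isOpenEmbedding_bend n
  constructor
  · rintro ⟨h, hh, hr, hs, ht, ha⟩
    obtain ⟨e, he, hbe, hc⟩ := exists_bend_section n
    have hho := ω.isOpenEmbedding h hh
    have hsq : ∀ {T : PreDiagram ℂ}, IsTangle k o n T → T.comap (bend n ∘ e) = T := fun hT => by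
      rw [hbe]
      exact hT.comap_coordMap_id strictMono_squeeze continuous_squeeze
        fun y => squeeze_of_nonpos
    refine ⟨h ∘ e, ω.comp_mem_positive hh he hc, (range_comp_subset_range _ _).trans hr, ?_, ?_, ?_⟩
    · rw [← PreDiagram.comap_comap, hs]
      exact (PreDiagram.comap_comap _ _ _).trans (hsq M.source_isTangle)
    · rw [← PreDiagram.comap_comap, ht]
      exact (PreDiagram.comap_comap _ _ _).trans (hsq M.target_isTangle)
    · intro p hp
      by_cases hpb : p ∈ h '' box (n + 1)
      · obtain ⟨z, hz, rfl⟩ := hpb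
        -- In the disk of the raised move, the pulled back tangles coincide outside of the disk of
        -- the given move.
        have hbz : bend n z ∉ box n := fun hbz => hp ⟨bend n z, hbz, by
          refine congrArg h (hb.injective ?_)
          exact (congrFun hbe _).trans (Complex.ext rfl (squeeze_of_nonpos hbz.2.2.2.le))⟩
        obtain ⟨h1, h2, h3⟩ := M.boundary_eq _ hbz
        refine ⟨?_, germ_eq_of_comap_eq hho (hD.1 _).1 (hD'.1 _).1 ?_,
          germ_eq_of_comap_eq hho (hD.1 _).2 (hD'.1 _).2 ?_⟩
        · have e1 : h z ∈ D.carrier ↔ bend n z ∈ M.source.carrier :=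
            Set.ext_iff.1 (congrArg PreDiagram.carrier hs) z
          have e2 : h z ∈ D'.carrier ↔ bend n z ∈ M.target.carrier :=
            Set.ext_iff.1 (congrArg PreDiagram.carrier ht) z
          rw [e1, e2, h1]
        · exact (congrFun (congrArg PreDiagram.overpass hs) z).trans
            ((congrArg (Filter.comap (bend n)) h2).trans
              (congrFun (congrArg PreDiagram.overpass ht) z).symm)
        · exact (congrFun (congrArg PreDiagram.fwd hs) z).trans
            ((congrArg (Filter.comap (bend n)) h3).trans
              (congrFun (congrArg PreDiagram.fwd ht) z).symm)
      · exact ha p hpb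
  · rintro ⟨h, hh, hr, hs, ht, ha⟩
    refine ⟨h ∘ bend n, ω.comp_mem_positive hh hb (eventually_bend_eq n),
      (range_comp_subset_range _ _).trans hr, ?_, ?_, fun p hp => ha p fun hpb => hp ?_⟩
    · rw [← PreDiagram.comap_comap, hs]; rfl
    · rw [← PreDiagram.comap_comap, ht]; rfl
    · rw [image_comp]
      exact image_mono (box_subset_image_bend n) hpb

end Surface

lemma exists_injective_quot_of_eq {α β : Type*} {r r' : α → α → Prop} (h : r = r') (f : Quot r → β)
    (hf : Function.Injective f) : ∃ f' : Quot r' → β, Function.Injective f' ∧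
      ∀ a, f (Quot.mk r a) = f' (Quot.mk r' a) := by
  subst h
  exact ⟨f, hf, fun _ => rfl⟩

end Skein

theorem mainTheorem3 {F : Type*} [TopologicalSpace F] [T2Space F] [SecondCountableTopology F]
    [ConnectedSpace F] [ChartedSpace (EuclideanHalfSpace 2) F]
    (ω : Skein.SurfaceOrientation F) (k : Skein.Kind) (s : Skein.Shape) (o : Bool)
    (X : Type*) (n : ℕ) (hn : 1 ≤ n) :
    Skein.skeinInvariants ω k s o X n ⊆ Skein.skeinInvariants ω k s o X (n + 1) := by
  rintro I ⟨𝓜, hfin, f, hf, rfl⟩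
  refine ⟨Skein.LocalMove.raise hn '' 𝓜, hfin.image _, ?_⟩
  -- The two sets of moves generate the same relation, hence have the same quotient.
  have hrel : (fun K K' : Skein.Knots ω k s o => ∃ (D D' : Skein.Diagram F k s o)
      (M : Skein.LocalMove k o n), Quot.mk _ D = K ∧ Quot.mk _ D' = K' ∧ M ∈ 𝓜 ∧
        Skein.Applies ω M D.1 D'.1) =
      fun K K' => ∃ (D D' : Skein.Diagram F k s o) (M : Skein.LocalMove k o (n + 1)),
        Quot.mk _ D = K ∧ Quot.mk _ D' = K' ∧ M ∈ Skein.LocalMove.raise hn '' 𝓜 ∧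
          Skein.Applies ω M D.1 D'.1 := by
    funext K K'
    refine propext ⟨?_, ?_⟩
    · rintro ⟨D, D', M, hK, hK', hM, hA⟩
      exact ⟨D, D', M.raise hn, hK, hK', mem_image_of_mem _ hM,
        (Skein.applies_raise_iff ω hn M D.2.1.2.1 D'.2.1.2.1).2 hA⟩
    · rintro ⟨D, D', _, hK, hK', ⟨M, hM, rfl⟩, hA⟩
      exact ⟨D, D', M, hK, hK', hM,
        (Skein.applies_raise_iff ω hn M D.2.1.2.1 D'.2.1.2.1).1 hA⟩
  obtain ⟨f', hf', hff'⟩ := Skein.exists_injective_quot_of_eq hrel f hf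
  exact ⟨f', hf', funext hff'⟩
end
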